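/- Let $f:\{0,1\}^n\to\{0,1\}$ be a Boolean function and let $k$ be the number of variables on which $f$ depends, i.e. the number of indices $i$ such that flipping $x_i$ changes the value of $f$ at some input. Let $H_f=\sum_x f(x)\,|x\rangle\langle x|$ be the Hamiltonian on $n$ qubits representing $f$ (the unique operator with $H_f|x\rangle=f(x)|x\rangle$ for all $x\in\{0,1\}^n$), and write $H_f=\sum_{S\subseteq[n]}\widehat f(S)\prod_{j\in S}Z_j$ with $Z_j$ the Pauli $Z$ operator on qubit $j$ and $\widehat f(S)=2^{-n}\operatorname{tr}\bigl(H_f\prod_{j\in S}Z_j\bigr)$. Let $\deg(H_f)$ be the largest $|S|$ with $\widehat f(S)\neq 0$ (and $0$ if $f\equiv 0$). Let $D(f)$ be the decision tree complexity of $f$, the least depth of a deterministic decision tree that computes $f$ by querying single bits. Then: (1) $k\ \ge\ D(f)\ \ge\ \deg(H_f)$ for all $n$ and all $f$. (2) $\deg(H_f)\ge \log_2 k-O(\log\log k)$: there is an absolute constant $C$ such that, for all $n$ and all $f$ with $k\ge 2$, $$\deg(H_f)\ \ge\ \log_2 k-C\,\log_2\log_2 k .$$ (3) $D(f)$ is polynomially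 bounded in $\deg(H_f)$: there are absolute constants $C,c\in\mathbb N$ such that $D(f)\le C\,\deg(H_f)^{c}$ for all $n$ and all $f$. -/

import Mathlib

namespace HamRep

/-- The class `B_n` of `n`-bit Boolean functions; `false` is the bit `0`, `true` the bit `1`. -/
abbrev BoolFun (n : ℕ) : Type := (Fin n → Bool) → Bool

/-- The value of a bit as a complex number, `0` or `1`. -/
def bitVal (b : Bool) : ℂ := if b then 1 else 0

/-! ### Variables on which a function depends -/

/-- `f` depends on the variable `x_i`: flipping this bit changes the value at some input. -/
def DependsOnVar {n : ℕ} (f : BoolFun n) (i : Fin n) : Prop :=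
  ∃ x : Fin n → Bool, f (Function.update x i (!x i)) ≠ f x

open Classical in
/-- The set of variables on which `f` depends. -/
noncomputable def relevantVars {n : ℕ} (f : BoolFun n) : Finset (Fin n) :=
  Finset.univ.filter (fun i => DependsOnVar f i)

/-! ### Decision trees -/

/-- Deterministic decision trees on `n` bits. `node i t₀ t₁` queries the bit `x_i` and continues
with `t₀` if it is `0` and with `t₁` if it is `1`. -/
inductive DecisionTree (n : ℕ) : Type where
  | leaf (b : Bool) : DecisionTree n
  | node (i : Fin n) (t₀ t₁ : DecisionTree n) : DecisionTree n

/-- The output of a decision tree on an input. -/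
def DecisionTree.eval {n : ℕ} : DecisionTree n → (Fin n → Bool) → Bool
  | .leaf b, _ => b
  | .node i t₀ t₁, x => if x i then t₁.eval x else t₀.eval x

/-- The depth of a decision tree: the largest number of queries made on any path. -/
def DecisionTree.depth {n : ℕ} : DecisionTree n → ℕ
  | .leaf _ => 0
  | .node _ t₀ t₁ => max t₀.depth t₁.depth + 1

/-- The tree `T` computes the function `f`. -/
def DecisionTree.Computes {n : ℕ} (T : DecisionTree n) (f : BoolFun n) : Prop :=
  ∀ x, T.eval x = f x

/-- The decision tree complexity `D(f)`: the least depth of a decision tree computing `f`. -/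
noncomputable def decisionTreeComplexity {n : ℕ} (f : BoolFun n) : ℕ :=
  sInf {d : ℕ | ∃ T : DecisionTree n, T.Computes f ∧ T.depth = d}

/-- Every Boolean function is computed by some decision tree, so the minimum above is attained. -/
theorem exists_decisionTree {n : ℕ} (f : BoolFun n) : ∃ T : DecisionTree n, T.Computes f := by
  have key : ∀ (l : List (Fin n)) (g : BoolFun n),
      (∀ x y : Fin n → Bool, (∀ i ∈ l, x i = y i) → g x = g y) →
      ∃ T : DecisionTree n, T.Computes g := by
    intro l
    induction l with
    | nil =>
      intro g hg
      exact ⟨.leaf (g fun _ => false), fun x => hg _ _ (by simp)⟩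
    | cons i l ih =>
      intro g hg
      have h : ∀ b : Bool, ∃ T : DecisionTree n,
          T.Computes (fun x => g (Function.update x i b)) := by
        intro b
        apply ih
        intro x y hxy
        apply hg
        intro j hj
        by_cases hji : j = i
        · subst hji; simp
        · rcases List.mem_cons.1 hj with h | h
          · exact absurd h hji
          · simp [Function.update_of_ne hji, hxy j h]
      obtain ⟨T₀, h₀⟩ := h false
      obtain ⟨T₁, h₁⟩ := h true
      refine ⟨.node i T₀ T₁, fun x => ?_⟩
      cases hx : x i with
      | false =>
        have e : Function.update x i false = x := by rw [← hx]; exact Function.update_eq_self i x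
        simp [DecisionTree.eval, hx, h₀ x, e]
      | true =>
        have e : Function.update x i true = x := by rw [← hx]; exact Function.update_eq_self i x
        simp [DecisionTree.eval, hx, h₁ x, e]
  refine key (List.finRange n) f (fun x y h => ?_)
  rw [funext fun i => h i (List.mem_finRange i)]

/-! ### Hamiltonians on `n` qubits, as matrices in the computational basis -/

/-- Operators on `n` qubits, in the computational basis indexed by bit strings. -/
abbrev QOp (n : ℕ) : Type := Matrix (Fin n → Bool) (Fin n → Bool) ℂ

/-- The computational basis state `|x⟩`. -/
def ket {n : ℕ} (x : Fin n → Bool) : (Fin n → Bool) → ℂ := Pi.single x 1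

/-- The tensor product `A_1 ⊗ ⋯ ⊗ A_n` of one-qubit operators. -/
def tensorOp {n : ℕ} (A : Fin n → Matrix Bool Bool ℂ) : QOp n :=
  Matrix.of fun x y => ∏ i, A i (x i) (y i)

/-- The Pauli operator `Z`: `Z|0⟩ = |0⟩` and `Z|1⟩ = -|1⟩`. -/
def pauliZ : Matrix Bool Bool ℂ := Matrix.diagonal fun b => if b then -1 else 1

/-- `Z_S`: the Pauli `Z` on every qubit of `S`, the identity on the others. -/
def zString {n : ℕ} (S : Finset (Fin n)) : QOp n :=
  tensorOp fun i => if i ∈ S then pauliZ else 1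

/-- The Hamiltonian `H_f = ∑_x f(x) |x⟩⟨x|` representing `f`. -/
noncomputable def hamiltonian {n : ℕ} (f : BoolFun n) : QOp n :=
  ∑ x, bitVal (f x) • Matrix.vecMulVec (ket x) (star (ket x))

/-- The coefficient `tr(H Z_S) / 2^n` of `Z_S` in the expansion of `H` into Pauli operators. -/
noncomputable def zCoeff {n : ℕ} (H : QOp n) (S : Finset (Fin n)) : ℂ :=
  (H * zString S).trace / 2 ^ n

open Classical in
/-- The degree of a diagonal Hamiltonian `H = ∑_S c_S Z_S`: the largest number `|S|` of qubits
acted on by a term with `c_S ≠ 0` (and `0` for `H = 0`). -/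
noncomputable def hamDegree {n : ℕ} (H : QOp n) : ℕ :=
  (Finset.univ.filter fun S : Finset (Fin n) => zCoeff H S ≠ 0).sup Finset.card

/-- `H_f` is the diagonal matrix with the values of `f` on its diagonal. -/
theorem hamiltonian_eq_diagonal {n : ℕ} (f : BoolFun n) :
    hamiltonian f = Matrix.diagonal fun x => bitVal (f x) := by
  ext x y
  simp only [hamiltonian, Matrix.sum_apply, Matrix.smul_apply, Matrix.vecMulVec_apply, ket,
    Pi.star_apply, Pi.single_apply, Matrix.diagonal_apply, smul_eq_mul]
  rw [Finset.sum_eq_single x]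
  · by_cases h : x = y
    · subst h; simp
    · simp [h, Ne.symm h]
  · intro b _ hb
    simp [Ne.symm hb]
  · simp

/-- `H_f` is the unique operator with `H_f|x⟩ = f(x)|x⟩` for every bit string `x`. -/
theorem represents_iff {n : ℕ} (f : BoolFun n) (H : QOp n) :
    (∀ x, H.mulVec (ket x) = bitVal (f x) • ket x) ↔ H = hamiltonian f := by
  rw [hamiltonian_eq_diagonal]
  constructor
  · intro h
    ext x y
    have := congrFun (h y) x
    simp only [ket, Matrix.mulVec_single_one, Pi.smul_apply, Pi.single_apply, smul_eq_mul,
      Matrix.col_apply] at this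
    rw [this, Matrix.diagonal_apply]
    by_cases hxy : x = y
    · subst hxy; simp
    · simp [hxy]
  · rintro rfl x
    ext y
    simp only [ket, Matrix.mulVec_single_one, Pi.smul_apply, Pi.single_apply, smul_eq_mul,
      Matrix.col_apply, Matrix.diagonal_apply]
    by_cases hxy : y = x
    · subst hxy; simp
    · simp [hxy]

/-- `Z_S|x⟩ = χ_S(x)|x⟩` with the parity function `χ_S(x) = ∏_{j ∈ S} (-1)^{x_j}`. -/
theorem zString_eq_diagonal {n : ℕ} (S : Finset (Fin n)) :
    zString S = Matrix.diagonal fun x => ∏ j ∈ S, if x j then (-1 : ℂ) else 1 := by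
  ext x y
  simp only [zString, tensorOp, Matrix.of_apply, Matrix.diagonal_apply]
  by_cases h : x = y
  · subst h
    rw [if_pos rfl, ← Finset.prod_subset (Finset.subset_univ S)]
    · refine Finset.prod_congr rfl fun i hi => ?_
      simp [hi, pauliZ]
    · intro i _ hi
      simp [hi]
  · rw [if_neg h]
    obtain ⟨i, hi⟩ := Function.ne_iff.1 h
    apply Finset.prod_eq_zero (Finset.mem_univ i)
    by_cases hS : i ∈ S
    · simp [hS, pauliZ, hi]
    · simp [hS, hi]

/-- The coefficients `zCoeff` are those of the expansion `H_f = ∑_S c_S Z_S`. -/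
theorem hamiltonian_expansion {n : ℕ} (f : BoolFun n) :
    hamiltonian f = ∑ S : Finset (Fin n), zCoeff (hamiltonian f) S • zString S := by
  have key : ∀ x y : Fin n → Bool,
      ∑ S : Finset (Fin n), (∏ j ∈ S, if x j then (-1 : ℂ) else 1) *
        (∏ j ∈ S, if y j then (-1 : ℂ) else 1) = if x = y then 2 ^ n else 0 := by
    intro x y
    simp_rw [← Finset.prod_mul_distrib]
    rw [← Finset.powerset_univ, ← Finset.prod_one_add]
    by_cases h : x = y
    · subst h
      have : ∀ i : Fin n, (1 : ℂ) + (if x i then (-1 : ℂ) else 1) * (if x i then (-1 : ℂ) else 1)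
          = 2 := by
        intro i; cases x i <;> norm_num
      rw [if_pos rfl, Finset.prod_congr rfl fun i _ => this i]
      simp
    · rw [if_neg h]
      obtain ⟨i, hi⟩ := Function.ne_iff.1 h
      apply Finset.prod_eq_zero (Finset.mem_univ i)
      revert hi
      cases x i <;> cases y i <;> norm_num
  ext x y
  simp only [hamiltonian_eq_diagonal, zCoeff, zString_eq_diagonal, Matrix.diagonal_mul_diagonal,
    Matrix.trace_diagonal, Matrix.sum_apply, Matrix.smul_apply, smul_eq_mul]
  by_cases h : x = y
  · subst h
    simp only [Matrix.diagonal_apply_eq]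
    simp_rw [Finset.sum_div, Finset.sum_mul]
    rw [Finset.sum_comm]
    have : ∀ z : Fin n → Bool, ∑ S : Finset (Fin n),
        bitVal (f z) * (∏ j ∈ S, if z j then (-1 : ℂ) else 1) / 2 ^ n *
          (∏ j ∈ S, if x j then (-1 : ℂ) else 1) = if z = x then bitVal (f x) else 0 := by
      intro z
      have e := key z x
      calc _ = bitVal (f z) / 2 ^ n * ∑ S : Finset (Fin n),
            (∏ j ∈ S, if z j then (-1 : ℂ) else 1) * (∏ j ∈ S, if x j then (-1 : ℂ) else 1) := by
              rw [Finset.mul_sum]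
              exact Finset.sum_congr rfl fun S _ => by ring
        _ = _ := by
              rw [e]
              by_cases hz : z = x
              · subst hz; simp
              · simp [hz]
    simp [this]
  · simp [Matrix.diagonal_apply_ne _ h]

end HamRep

namespace HamRep

/-! ### A Markov-type inequality for polynomials bounded on the unit interval -/

/-! Everything reduces to `f` as a real function on the cube, given by a polynomial of degree `d`.
The substitution `z = 1 - 2x` between monomials and characters preserves degree, so `d` may be taken
to be the degree of the Hamiltonian. A decision tree of depth `D` gives a polynomial of degree at
most `D`, and querying the relevant variables suffices; this is (1).

The engine for (2) and (3) is `card_blocks_le`: at most `4 d ^ 2` disjoint blocks can each change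
the value of `f` when flipped. Flipping each block independently with probability `t` makes the
expected value of `f` a polynomial in `t` of degree at most `d`, with values in `[0, 1]`, whose
derivative at `0` is plus or minus the number of blocks; `abs_coeff_one_le` bounds that derivative.

For (2), a nonzero function of degree `d` is nonzero on at least a fraction `2 ^ (-d)` of the cube.
Applied to the discrete derivatives of `f`, this makes each relevant variable sensitive that often,
while each point has at most `4 d ^ 2` sensitive variables. Double counting gives `k ≤ 4 d ^ 2 * 2 ^
d`.

For (3), a maximal disjoint family of top-degree monomials contains disjoint sensitive blocks, so it
is small, and its variables meet every top-degree monomial. Querying them lowers the degree;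
iterating gives depth at most `4 d ^ 4`. -/

theorem prod_range_sq_div_sq_sub (q : ℕ) :
    ∏ i ∈ Finset.range q, ((i : ℝ) + 1) ^ 2 / |((i : ℝ) + 1) ^ 2 - ((q : ℝ) + 1) ^ 2| =
      2 * ((q + 1).factorial : ℝ) ^ 2 / ((2 * q + 2).factorial : ℝ) := by
  have h1 : ∀ i ∈ Finset.range q,
      ((i : ℝ) + 1) ^ 2 / |((i : ℝ) + 1) ^ 2 - ((q : ℝ) + 1) ^ 2| =
        (((i + 1 : ℕ) : ℝ) * ((i + 1 : ℕ) : ℝ)) / (((q - i : ℕ) : ℝ) * ((q + 1 + 1 + i : ℕ) : ℝ)) := by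
    intro i hi
    have hiq : (i : ℝ) < q := by exact_mod_cast Finset.mem_range.1 hi
    rw [abs_sub_comm, abs_of_nonneg, Nat.cast_sub (Finset.mem_range.1 hi).le]
    · push_cast; congr 1 <;> ring
    · have : (0 : ℝ) ≤ i := by positivity
      nlinarith
  have h2 : ∏ i ∈ Finset.range q, (i + 1) = q.factorial := Finset.prod_range_add_one_eq_factorial q
  have h3 : ∏ i ∈ Finset.range q, (q - i) = q.factorial := by
    rw [← h2, ← Finset.prod_range_reflect]
    refine Finset.prod_congr rfl fun i hi => ?_
    have := Finset.mem_range.1 hi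
    omega
  have h4 : (q + 1).factorial * ∏ i ∈ Finset.range q, (q + 1 + 1 + i) = (2 * q + 1).factorial := by
    rw [← Nat.ascFactorial_eq_prod_range, Nat.factorial_mul_ascFactorial]
    congr 1; ring
  rw [Finset.prod_congr rfl h1, Finset.prod_div_distrib, Finset.prod_mul_distrib,
    Finset.prod_mul_distrib, ← Nat.cast_prod, ← Nat.cast_prod, ← Nat.cast_prod, h2, h3]
  have h5 : ((2 * q + 2).factorial : ℝ) = 2 * (q + 1) * ((q + 1).factorial *
      ((∏ i ∈ Finset.range q, (q + 1 + 1 + i) : ℕ) : ℝ)) := by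
    rw [← Nat.cast_mul, h4, Nat.factorial_succ]
    push_cast; ring
  have h6 : ((∏ i ∈ Finset.range q, (q + 1 + 1 + i) : ℕ) : ℝ) ≠ 0 := by
    rw [Nat.cast_ne_zero, Finset.prod_ne_zero_iff]
    intro i _; omega
  have h7 : (q.factorial : ℝ) ≠ 0 := by positivity
  rw [h5, Nat.factorial_succ q]
  push_cast
  push_cast at h6
  field_simp

theorem prod_erase_sq_div_sq_sub (q m : ℕ) :
    ∏ i ∈ (Finset.range (q + 1 + m)).erase q,
        ((i : ℝ) + 1) ^ 2 / |((i : ℝ) + 1) ^ 2 - ((q : ℝ) + 1) ^ 2| =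
      2 * ((q + 1 + m).factorial : ℝ) ^ 2 / (m.factorial * (2 * q + 2 + m).factorial : ℝ) := by
  induction m with
  | zero =>
    have : (Finset.range (q + 1 + 0)).erase q = Finset.range q := by
      ext i; simp; omega
    rw [this, prod_range_sq_div_sq_sub]
    simp
  | succ m ih =>
    have : (Finset.range (q + 1 + (m + 1))).erase q =
        insert (q + 1 + m) ((Finset.range (q + 1 + m)).erase q) := by
      ext i; simp; omega
    rw [this, Finset.prod_insert (by simp), ih, abs_of_nonneg]
    · have e1 : (q + 1 + (m + 1)).factorial = (q + 1 + m + 1) * (q + 1 + m).factorial := by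
        rw [← Nat.factorial_succ]; rfl
      have e2 : (2 * q + 2 + (m + 1)).factorial =
          (2 * q + 2 + m + 1) * (2 * q + 2 + m).factorial := by
        rw [← Nat.factorial_succ]; rfl
      rw [e1, e2, Nat.factorial_succ m]
      have e3 : ((q + 1 + m : ℕ) + 1 : ℝ) ^ 2 - (q + 1) ^ 2 = (m + 1) * (2 * q + 2 + m + 1) := by
        push_cast; ring
      rw [e3]
      push_cast
      field_simp
    · push_cast
      have : (0 : ℝ) ≤ q := by positivity
      have : (0 : ℝ) ≤ m := by positivity
      nlinarith

/-- With `m = d - q - 1`, the closed form is `2 * (2d).choose m / (2d).choose d`, and the central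
binomial coefficient is the largest. -/
theorem prod_erase_sq_div_sq_sub_le {q d : ℕ} (hq : q < d) :
    ∏ i ∈ (Finset.range d).erase q,
        ((i : ℝ) + 1) ^ 2 / |((i : ℝ) + 1) ^ 2 - ((q : ℝ) + 1) ^ 2| ≤ 2 := by
  obtain ⟨m, rfl⟩ := Nat.exists_eq_add_of_le hq
  rw [Nat.succ_eq_add_one, prod_erase_sq_div_sq_sub, div_le_iff₀ (by positivity)]
  have h := Nat.choose_le_centralBinom m (q + 1 + m)
  have h1 := Nat.choose_mul_factorial_mul_factorial (show m ≤ 2 * (q + 1 + m) by omega)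
  have h2 := Nat.choose_mul_factorial_mul_factorial
    (show q + 1 + m ≤ 2 * (q + 1 + m) by omega)
  rw [Nat.centralBinom] at h
  rw [show 2 * (q + 1 + m) - m = 2 * q + 2 + m by omega] at h1
  rw [show 2 * (q + 1 + m) - (q + 1 + m) = q + 1 + m by omega] at h2
  have hpos : 0 < (2 * (q + 1 + m)).choose (q + 1 + m) := Nat.choose_pos (by omega)
  have key : (q + 1 + m).factorial ^ 2 ≤ m.factorial * (2 * q + 2 + m).factorial := by
    refine Nat.le_of_mul_le_mul_left ?_ hpos
    calc _ = (2 * (q + 1 + m)).choose m * m.factorial * (2 * q + 2 + m).factorial := by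
          rw [h1, ← h2]; ring
      _ ≤ (2 * (q + 1 + m)).choose (q + 1 + m) * m.factorial * (2 * q + 2 + m).factorial := by
          gcongr
      _ = _ := by ring
  have : ((q + 1 + m).factorial : ℝ) ^ 2 ≤ m.factorial * (2 * q + 2 + m).factorial := by
    exact_mod_cast key
  linarith

theorem sum_range_inv_succ_sq_le (d : ℕ) :
    ∑ i ∈ Finset.range d, 1 / ((i : ℝ) + 1) ^ 2 ≤ 2 := by
  rcases d with _ | d
  · simp
  -- The sharper bound is the one that telescopes.
  suffices h : ∑ i ∈ Finset.range (d + 1), 1 / ((i : ℝ) + 1) ^ 2 ≤ 2 - 1 / ((d : ℝ) + 1) from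
    h.trans (sub_le_self _ (by positivity))
  induction d with
  | zero => norm_num
  | succ d ih =>
    rw [Finset.sum_range_succ]
    have : 1 / (((d + 1 : ℕ) : ℝ) + 1) ^ 2 ≤ 1 / ((d : ℝ) + 1) - 1 / (((d + 1 : ℕ) : ℝ) + 1) := by
      push_cast
      rw [div_sub_div _ _ (by positivity) (by positivity), div_le_div_iff₀ (by positivity)
        (by positivity)]
      have : (0 : ℝ) ≤ d := by positivity
      nlinarith
    linarith

/-- The linear coefficient is the value at `0` of `(p - p(0)) / X`, which has degree below `d` and
is recovered by Lagrange interpolation at `d` nodes. Squared nodes cluster near `0`, which keeps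
every basis polynomial at most `2` there; the factors `1 / v i` then sum to at most `2 * d ^ 2`. -/
theorem abs_coeff_one_le {p : Polynomial ℝ} {d : ℕ} (hd : p.natDegree ≤ d)
    (hp : ∀ t ∈ Set.Icc (0 : ℝ) 1, |p.eval t - p.eval 0| ≤ 1) :
    |p.coeff 1| ≤ 4 * (d : ℝ) ^ 2 := by
  rcases Nat.eq_zero_or_pos d with rfl | hd0
  · rw [Polynomial.coeff_eq_zero_of_natDegree_lt (by omega)]
    simp
  set v : ℕ → ℝ := fun i => (((i : ℝ) + 1) / d) ^ 2 with hv
  have hdpos : (0 : ℝ) < d := by exact_mod_cast hd0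
  have hvinj : Set.InjOn v (Finset.range d : Finset ℕ) := by
    intro i _ j _ hij
    have := (pow_left_inj₀ (by positivity) (by positivity) two_ne_zero).1 hij
    rw [div_left_inj' hdpos.ne'] at this
    exact_mod_cast add_right_cancel this
  have hdeg : p.divX.degree < ((Finset.range d).card : WithBot ℕ) := by
    rw [Finset.card_range]
    refine lt_of_le_of_lt Polynomial.degree_le_natDegree ?_
    rw [Polynomial.natDegree_divX_eq_natDegree_tsub_one]
    exact_mod_cast (by omega : p.natDegree - 1 < d)
  have hL := congrArg (Polynomial.eval 0) (Lagrange.eq_interpolate hvinj hdeg)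
  have hcoeff : p.coeff 1 = p.divX.eval 0 := by
    rw [← Polynomial.coeff_zero_eq_eval_zero, Polynomial.coeff_divX]
  have hr : ∀ i ∈ Finset.range d, |p.divX.eval (v i)| ≤ (d : ℝ) ^ 2 * (1 / ((i : ℝ) + 1) ^ 2) := by
    intro i hi
    have hid : (i : ℝ) + 1 ≤ d := by exact_mod_cast Finset.mem_range.1 hi
    have hvpos : 0 < v i := by positivity
    have hv1 : v i ≤ 1 := pow_le_one₀ (by positivity) ((div_le_one hdpos).2 hid)
    have h1 := hp (v i) ⟨hvpos.le, hv1⟩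
    have h2 := congrArg (Polynomial.eval (v i)) (Polynomial.divX_mul_X_add p)
    rw [Polynomial.eval_add, Polynomial.eval_mul, Polynomial.eval_X, Polynomial.eval_C,
      Polynomial.coeff_zero_eq_eval_zero] at h2
    rw [← h2, add_sub_cancel_right, abs_mul, abs_of_pos hvpos, ← le_div_iff₀ hvpos] at h1
    refine h1.trans_eq ?_
    simp only [hv]
    field_simp
  have hB : ∀ i ∈ Finset.range d, |(Lagrange.basis (Finset.range d) v i).eval 0| ≤ 2 := by
    intro i hi
    refine le_trans (le_of_eq ?_) (prod_erase_sq_div_sq_sub_le (Finset.mem_range.1 hi))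
    rw [Lagrange.basis, Polynomial.eval_prod, Finset.abs_prod]
    refine Finset.prod_congr rfl fun j hj => ?_
    have e : v i - v j = -((((j : ℝ) + 1) ^ 2 - ((i : ℝ) + 1) ^ 2) / (d : ℝ) ^ 2) := by
      simp only [hv]; field_simp; ring
    have e2 : v j = ((j : ℝ) + 1) ^ 2 / (d : ℝ) ^ 2 := by simp only [hv, div_pow]
    rw [Lagrange.basisDivisor, Polynomial.eval_mul, Polynomial.eval_C, Polynomial.eval_sub,
      Polynomial.eval_X, Polynomial.eval_C, e, e2, zero_sub, abs_mul, abs_inv, abs_neg, abs_neg,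
      abs_div, abs_div, abs_of_pos (show (0 : ℝ) < (d : ℝ) ^ 2 by positivity),
      abs_of_pos (show (0 : ℝ) < ((j : ℝ) + 1) ^ 2 by positivity), inv_div,
      div_mul_div_comm, mul_comm, mul_div_mul_right _ _ (by positivity)]
  rw [hcoeff, hL, Lagrange.interpolate_apply, Polynomial.eval_finsetSum]
  calc _ ≤ ∑ i ∈ Finset.range d, (d : ℝ) ^ 2 * (1 / ((i : ℝ) + 1) ^ 2) * 2 := by
        refine (Finset.abs_sum_le_sum_abs _ _).trans (Finset.sum_le_sum fun i hi => ?_)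
        rw [Polynomial.eval_mul, Polynomial.eval_C, abs_mul]
        exact mul_le_mul (hr i hi) (hB i hi) (abs_nonneg _) (by positivity)
    _ = 2 * (d : ℝ) ^ 2 * ∑ i ∈ Finset.range d, 1 / ((i : ℝ) + 1) ^ 2 := by
        rw [Finset.mul_sum]
        exact Finset.sum_congr rfl fun i _ => by ring
    _ ≤ 2 * (d : ℝ) ^ 2 * 2 := by
        gcongr
        exact sum_range_inv_succ_sq_le d
    _ = _ := by ring

/-! ### Polynomials on the Boolean cube -/

section BooleanCube

/-- The value of a bit as a real number. -/
def bitReal (b : Bool) : ℝ := if b then 1 else 0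

theorem bitReal_sub_of_ne {a b : Bool} (h : a ≠ b) :
    bitReal a - bitReal b = if b then -1 else 1 := by
  cases a <;> cases b <;> simp [bitReal] at h ⊢

/-- The real-valued function `x ↦ f x ∈ {0, 1}`. -/
def realFun {ι : Type*} (f : (ι → Bool) → Bool) : (ι → Bool) → ℝ := fun x => bitReal (f x)

/-- The multilinear monomial `∏ i ∈ S, x_i`. -/
def monom {ι : Type*} (S : Finset ι) : (ι → Bool) → ℝ := fun x => ∏ i ∈ S, bitReal (x i)

/-- The bit string with support `S`. -/
def indic {ι : Type*} [DecidableEq ι] (S : Finset ι) : ι → Bool := fun i => decide (i ∈ S)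

/-- The real functions on the Boolean cube given by polynomials of degree at most `d`. -/
def degLE (ι : Type*) (d : ℕ) : Submodule ℝ ((ι → Bool) → ℝ) :=
  Submodule.span ℝ (monom '' {S : Finset ι | S.card ≤ d})

variable {ι : Type*}

theorem monom_mem_degLE {S : Finset ι} {d : ℕ} (h : S.card ≤ d) : monom S ∈ degLE ι d :=
  Submodule.subset_span ⟨S, h, rfl⟩

theorem degLE_mono {d e : ℕ} (h : d ≤ e) : degLE ι d ≤ degLE ι e :=
  Submodule.span_mono (Set.image_mono fun _ hS => le_trans hS h)

variable [DecidableEq ι]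

theorem monom_indic (S V : Finset ι) : monom S (indic V) = if S ⊆ V then 1 else 0 := by
  split_ifs with h
  · exact Finset.prod_eq_one fun i hi => by simp [bitReal, indic, h hi]
  · obtain ⟨i, hi, hV⟩ := Finset.not_subset.1 h
    exact Finset.prod_eq_zero hi (by simp [bitReal, indic, hV])

/-- Only nonconstant factors count towards the degree. This covers bit flips, restrictions and
characters alike. -/
theorem prod_affine_mem_degLE (S : Finset ι) (a b : ι → ℝ) {d : ℕ}
    (h : (S.filter fun i => b i ≠ 0).card ≤ d) :
    (fun x => ∏ i ∈ S, (b i * bitReal (x i) + a i)) ∈ degLE ι d := by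
  have e : (fun x : ι → Bool => ∏ i ∈ S, (b i * bitReal (x i) + a i)) =
      ∑ T ∈ S.powerset, ((∏ i ∈ T, b i) * ∏ i ∈ S \ T, a i) • monom T := by
    ext x
    rw [Finset.prod_add, Finset.sum_apply]
    refine Finset.sum_congr rfl fun T _ => ?_
    rw [Finset.prod_mul_distrib, Pi.smul_apply, smul_eq_mul, monom]
    ring
  rw [e]
  refine Submodule.sum_mem _ fun T hT => ?_
  by_cases h0 : ∏ i ∈ T, b i = 0
  · simp [h0]
  · refine Submodule.smul_mem _ _ (monom_mem_degLE ((Finset.card_le_card fun i hi => ?_).trans h))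
    exact Finset.mem_filter.2 ⟨Finset.mem_powerset.1 hT hi, (Finset.prod_ne_zero_iff.1 h0) i hi⟩

theorem bitReal_xor (a b : Bool) : bitReal (xor a b) = (1 - 2 * bitReal a) * bitReal b + bitReal a := by
  cases a <;> cases b <;> norm_num [bitReal]

theorem comp_xor_mem_degLE {d : ℕ} {h : (ι → Bool) → ℝ} (hh : h ∈ degLE ι d) (z : ι → Bool) :
    (fun x => h fun i => xor (z i) (x i)) ∈ degLE ι d := by
  induction hh using Submodule.span_induction with
  | mem h hm =>
    obtain ⟨S, hS, rfl⟩ := hm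
    simp only [monom, bitReal_xor]
    exact prod_affine_mem_degLE S _ _ ((Finset.card_filter_le _ _).trans hS)
  | zero => exact Submodule.zero_mem _
  | add f g _ _ hf hg => exact Submodule.add_mem _ hf hg
  | smul a f _ hf => exact Submodule.smul_mem _ a hf

theorem mul_bitReal_mem_degLE {d : ℕ} {h : (ι → Bool) → ℝ} (hh : h ∈ degLE ι d) (i : ι) :
    (fun x => bitReal (x i) * h x) ∈ degLE ι (d + 1) := by
  induction hh using Submodule.span_induction with
  | mem h hm =>
    obtain ⟨S, hS, rfl⟩ := hm
    have : (fun x : ι → Bool => bitReal (x i) * monom S x) = monom (insert i S) := by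
      ext x
      by_cases hi : i ∈ S
      · rw [Finset.insert_eq_of_mem hi, monom, ← Finset.mul_prod_erase S _ hi, ← mul_assoc]
        congr 1
        cases x i <;> simp [bitReal]
      · rw [monom, monom, Finset.prod_insert hi]
    rw [this]
    exact monom_mem_degLE ((Finset.card_insert_le _ _).trans (Nat.succ_le_succ hS))
  | zero =>
    convert Submodule.zero_mem (degLE ι (d + 1)) using 1
    ext x; simp
  | add f g _ _ hf hg =>
    convert Submodule.add_mem _ hf hg using 1
    ext x; simp [mul_add]
  | smul a f _ hf =>
    convert Submodule.smul_mem _ a hf using 1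
    ext x; simp [mul_left_comm]

variable [Fintype ι]

theorem exists_coeff_of_mem_degLE {d : ℕ} {h : (ι → Bool) → ℝ} (hh : h ∈ degLE ι d) :
    ∃ c : Finset ι → ℝ, (∀ S, d < S.card → c S = 0) ∧ ∀ x, h x = ∑ S, c S * monom S x := by
  induction hh using Submodule.span_induction with
  | mem h hm =>
    obtain ⟨S, hS, rfl⟩ := hm
    refine ⟨Pi.single S 1, fun T hT => Pi.single_eq_of_ne ?_ 1, fun x => ?_⟩
    · rintro rfl
      exact absurd hT (not_lt.2 hS)
    · simp [Pi.single_apply]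
  | zero => exact ⟨0, by simp⟩
  | add f g _ _ hf hg =>
    obtain ⟨c, hc, hc'⟩ := hf
    obtain ⟨e, he, he'⟩ := hg
    exact ⟨c + e, fun S hS => by simp [hc S hS, he S hS],
      fun x => by simp [hc', he', add_mul, Finset.sum_add_distrib]⟩
  | smul a f _ hf =>
    obtain ⟨c, hc, hc'⟩ := hf
    exact ⟨a • c, fun S hS => by simp [hc S hS], fun x => by simp [hc', Finset.mul_sum, mul_assoc]⟩

/-- At the indicator of a minimal `V ⊆ S` with nonzero coefficient, every other monomial vanishes or
has coefficient zero. -/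
theorem exists_indic_of_coeff_ne_zero {h : (ι → Bool) → ℝ} {c : Finset ι → ℝ}
    (hc : ∀ x, h x = ∑ S, c S * monom S x) {S : Finset ι} (hS : c S ≠ 0) :
    ∃ V ⊆ S, h (indic V) ≠ 0 := by
  obtain ⟨V, hV⟩ := (Finset.univ.filter fun U => U ⊆ S ∧ c U ≠ 0).exists_minimal
    ⟨S, by simp [hS]⟩
  have hV1 := hV.prop
  rw [Finset.mem_filter] at hV1
  refine ⟨V, hV1.2.1, ?_⟩
  rw [hc, Finset.sum_eq_single V]
  · simpa [monom_indic] using hV1.2.2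
  · intro U _ hU
    rw [monom_indic]
    split_ifs with hUV
    · rw [mul_one]
      by_contra hcU
      exact hU (subset_antisymm hUV (hV.le_of_le (y := U)
        (by simp [hUV.trans hV1.2.1, hcU]) hUV))
    · rw [mul_zero]
  · simp

theorem exists_block_of_coeff_ne_zero {h : (ι → Bool) → ℝ} {c : Finset ι → ℝ}
    (hc : ∀ x, h x = ∑ S, c S * monom S x) {S : Finset ι} (hS : c S ≠ 0) (hne : S.Nonempty) :
    ∃ V ⊆ S, h (indic V) ≠ h (indic ∅) := by
  obtain ⟨V, hV, hV'⟩ := exists_indic_of_coeff_ne_zero (h := fun x => h x - h (indic ∅))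
    (c := c - Pi.single ∅ (h (indic ∅))) (S := S)
    (fun x => by simp [hc x, sub_mul, Finset.sum_sub_distrib, Pi.single_apply, monom])
    (by simp [hne.ne_empty, hS])
  exact ⟨V, hV, sub_ne_zero.1 hV'⟩

/-! ### Block sensitivity -/

/-- This is the probability that a random subset of `A`, taking each element independently with
probability `t`, contains `J`. -/
theorem sum_powerset_weight {α : Type*} [DecidableEq α] {A J : Finset α} (hJ : J ⊆ A) (t : ℝ) :
    ∑ Y ∈ A.powerset, (if J ⊆ Y then t ^ Y.card * (1 - t) ^ (A \ Y).card else 0) =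
      t ^ J.card := by
  have h := Finset.prod_add (fun _ : α => t) (fun a => if a ∈ J then 0 else 1 - t) A
  have h1 : ∏ a ∈ A, (t + if a ∈ J then 0 else 1 - t) = t ^ J.card := by
    rw [← Finset.prod_subset hJ, Finset.prod_congr rfl fun a ha => ?_, Finset.prod_const]
    · simp [ha]
    · intro a _ ha; simp [ha]
  rw [← h1, h]
  refine Finset.sum_congr rfl fun Y _ => ?_
  rw [Finset.prod_const]
  split_ifs with hY
  · congr 1
    rw [← Finset.prod_const]
    refine Finset.prod_congr rfl fun a ha => ?_
    rw [if_neg fun haJ => (Finset.mem_sdiff.1 ha).2 (hY haJ)]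
  · obtain ⟨a, ha, haY⟩ := Finset.not_subset.1 hY
    rw [Finset.prod_eq_zero (Finset.mem_sdiff.2 ⟨hJ ha, haY⟩) (by simp [ha]), mul_zero]

theorem card_blocks_le {α : Type*} [DecidableEq α] {d : ℕ} {f : (ι → Bool) → Bool}
    (hf : realFun f ∈ degLE ι d) (A : Finset α) (B : α → Finset ι)
    (hdisj : (A : Set α).PairwiseDisjoint B)
    (hB : ∀ a ∈ A, f (indic (B a)) ≠ f (indic ∅)) :
    A.card ≤ 4 * d ^ 2 := by
  obtain ⟨c, hc0, hc⟩ := exists_coeff_of_mem_degLE hf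
  -- The blocks met by `S`. Giving all variables of a block one common value turns `monom S` into
  -- the monomial of `J S` in block variables, or into zero if `S` leaves the union of the blocks.
  set J : Finset ι → Finset α := fun S => A.filter fun a => ¬ Disjoint (B a) S with hJdef
  have hJA : ∀ S, J S ⊆ A := fun S => Finset.filter_subset _ _
  have hJcard : ∀ S, (J S).card ≤ S.card := by
    intro S
    refine (Finset.card_le_card_biUnion (f := fun a => B a ∩ S) ?_ ?_).trans
      (Finset.card_le_card (Finset.biUnion_subset.2 fun a _ => Finset.inter_subset_right))
    · intro a ha b hb hab
      exact (hdisj (hJA S ha) (hJA S hb) hab).mono Finset.inter_subset_left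
        Finset.inter_subset_left
    · intro a ha
      exact Finset.not_disjoint_iff_nonempty_inter.1 (Finset.mem_filter.1 ha).2
  have hsub : ∀ Y ⊆ A, ∀ S, S ⊆ Y.biUnion B ↔ S ⊆ A.biUnion B ∧ J S ⊆ Y := by
    intro Y hY S
    constructor
    · intro h
      refine ⟨h.trans (Finset.biUnion_subset_biUnion_of_subset_left B hY), fun a ha => ?_⟩
      obtain ⟨haA, hd⟩ := Finset.mem_filter.1 ha
      obtain ⟨s, hsa, hsS⟩ := Finset.not_disjoint_iff.1 hd
      obtain ⟨y, hy, hsy⟩ := Finset.mem_biUnion.1 (h hsS)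
      have : a = y := by
        by_contra hne
        exact Finset.disjoint_left.1 (hdisj haA (hY hy) hne) hsa hsy
      exact this ▸ hy
    · rintro ⟨h1, h2⟩ s hs
      obtain ⟨a, ha, hsa⟩ := Finset.mem_biUnion.1 (h1 hs)
      exact Finset.mem_biUnion.2 ⟨a, h2 (Finset.mem_filter.2
        ⟨ha, Finset.not_disjoint_iff.2 ⟨s, hsa, hs⟩⟩), hsa⟩
  set e : Finset ι → ℝ := fun S => if S ⊆ A.biUnion B then c S else 0 with hedef
  set g : Finset α → ℝ := fun Y => realFun f (indic (Y.biUnion B)) with hgdef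
  have hg : ∀ Y ⊆ A, g Y = ∑ S, e S * if J S ⊆ Y then 1 else 0 := by
    intro Y hY
    simp only [hgdef, hc, monom_indic, hsub Y hY, hedef]
    refine Finset.sum_congr rfl fun S _ => ?_
    by_cases h1 : S ⊆ A.biUnion B <;> simp [h1]
  -- All block variables are set to `t`; `hpeval` identifies the result with an expectation of `g`.
  set p : Polynomial ℝ := ∑ S, Polynomial.C (e S) * Polynomial.X ^ (J S).card with hp
  have hpdeg : p.natDegree ≤ d := by
    refine Polynomial.natDegree_sum_le_of_forall_le _ _ fun S _ => ?_
    by_cases hS : d < S.card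
    · simp [hedef, hc0 S hS]
    · exact (Polynomial.natDegree_C_mul_X_pow_le _ _).trans ((hJcard S).trans (not_lt.1 hS))
  have hpeval : ∀ t, p.eval t = ∑ Y ∈ A.powerset, g Y * (t ^ Y.card * (1 - t) ^ (A \ Y).card) := by
    intro t
    simp only [hp, Polynomial.eval_finsetSum, Polynomial.eval_mul, Polynomial.eval_C,
      Polynomial.eval_pow, Polynomial.eval_X]
    have h1 : ∀ Y ∈ A.powerset, g Y * (t ^ Y.card * (1 - t) ^ (A \ Y).card) =
        ∑ S, e S * (if J S ⊆ Y then 1 else 0) * (t ^ Y.card * (1 - t) ^ (A \ Y).card) :=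
      fun Y hY => by rw [hg Y (Finset.mem_powerset.1 hY), Finset.sum_mul]
    rw [Finset.sum_congr rfl h1, Finset.sum_comm]
    refine Finset.sum_congr rfl fun S _ => ?_
    rw [← sum_powerset_weight (hJA S) t, Finset.mul_sum]
    refine Finset.sum_congr rfl fun Y _ => ?_
    split_ifs <;> ring
  have hg01 : ∀ Y, 0 ≤ g Y ∧ g Y ≤ 1 := by
    intro Y
    simp only [hgdef, realFun, bitReal]
    split_ifs <;> norm_num
  have hp01 : ∀ t ∈ Set.Icc (0 : ℝ) 1, 0 ≤ p.eval t ∧ p.eval t ≤ 1 := by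
    rintro t ⟨ht0, ht1⟩
    have hw : ∀ Y : Finset α, 0 ≤ t ^ Y.card * (1 - t) ^ (A \ Y).card := fun Y =>
      mul_nonneg (pow_nonneg ht0 _) (pow_nonneg (sub_nonneg.2 ht1) _)
    rw [hpeval]
    refine ⟨Finset.sum_nonneg fun Y _ => mul_nonneg (hg01 Y).1 (hw Y), ?_⟩
    calc _ ≤ ∑ Y ∈ A.powerset, t ^ Y.card * (1 - t) ^ (A \ Y).card :=
          Finset.sum_le_sum fun Y _ => mul_le_of_le_one_left (hw Y) (hg01 Y).2
      _ = 1 := by simpa using sum_powerset_weight (Finset.empty_subset A) t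
  have hmarkov : |p.coeff 1| ≤ 4 * (d : ℝ) ^ 2 := by
    refine abs_coeff_one_le hpdeg fun t ht => ?_
    have h1 := hp01 t ht
    have h0 := hp01 0 ⟨le_rfl, zero_le_one⟩
    rw [abs_le]
    constructor <;> linarith [h1.1, h1.2, h0.1, h0.2]
  have hcoeff : p.coeff 1 = ∑ a ∈ A, (g {a} - g ∅) := by
    rw [Finset.sum_congr rfl fun a ha => by
      rw [hg {a} (Finset.singleton_subset_iff.2 ha), hg ∅ (Finset.empty_subset A),
        ← Finset.sum_sub_distrib], Finset.sum_comm]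
    simp only [hp, Polynomial.finsetSum_coeff, Polynomial.coeff_C_mul, Polynomial.coeff_X_pow,
      ← mul_sub, ← Finset.mul_sum]
    refine Finset.sum_congr rfl fun S _ => ?_
    congr 1
    by_cases h1 : (J S).card = 1
    · obtain ⟨b, hb⟩ := Finset.card_eq_one.1 h1
      have hbA : b ∈ A := hJA S (by simp [hb])
      simp [hb, hbA]
    · rw [if_neg (Ne.symm h1)]
      refine (Finset.sum_eq_zero fun a _ => ?_).symm
      by_cases h0 : J S = ∅
      · simp [h0]
      · rw [if_neg, if_neg (by rwa [Finset.subset_empty]), sub_zero]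
        rw [Finset.subset_singleton_iff, not_or]
        exact ⟨h0, fun h => h1 (by simp [h])⟩
  -- The differences all have the same sign, determined by the value at the base point, so nothing
  -- cancels.
  have hA : |∑ a ∈ A, (g {a} - g ∅)| = A.card := by
    have hval : ∀ a ∈ A, g {a} - g ∅ = if f (indic ∅) then -1 else 1 := by
      intro a ha
      simp only [hgdef, realFun, Finset.singleton_biUnion, Finset.biUnion_empty]
      exact bitReal_sub_of_ne (hB a ha)
    rw [Finset.sum_congr rfl hval, Finset.sum_const, nsmul_eq_mul, abs_mul, Nat.abs_cast]
    split_ifs <;> simp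
  rw [hcoeff, hA] at hmarkov
  exact_mod_cast hmarkov

end BooleanCube

/-! ### The number of relevant variables of a function of bounded degree -/

section Counting

variable {ι : Type*} [DecidableEq ι] [Fintype ι]

/-- Fixing the variables outside `S` leaves the coefficient of `monom S` unchanged, since only
supersets of `S` could contribute to it. The restriction is therefore nonzero. -/
theorem exists_piecewise_ne_zero {h : (ι → Bool) → ℝ} {c : Finset ι → ℝ}
    (hc : ∀ x, h x = ∑ S, c S * monom S x) {S : Finset ι}
    (hS : ∀ U, S ⊆ U → (c U ≠ 0 ↔ U = S)) (x : ι → Bool) :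
    ∃ y, h (S.piecewise y x) ≠ 0 := by
  have key : ∀ y, h (S.piecewise y x) = ∑ V, (∑ U with U ∩ S = V, c U * monom (U \ S) x) *
      monom V y := by
    intro y
    simp_rw [Finset.sum_mul, Finset.sum_filter]
    rw [hc, Finset.sum_comm]
    refine Finset.sum_congr rfl fun U _ => ?_
    rw [Finset.sum_ite_eq, if_pos (Finset.mem_univ _), mul_assoc]
    congr 1
    rw [monom, ← Finset.prod_sdiff (Finset.inter_subset_left (s₁ := U) (s₂ := S)),
      Finset.sdiff_inter_self_left]
    congr 1
    · exact Finset.prod_congr rfl fun i hi => by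
        rw [Finset.piecewise_eq_of_notMem _ _ _ (Finset.mem_sdiff.1 hi).2]
    · exact Finset.prod_congr rfl fun i hi => by
        rw [Finset.piecewise_eq_of_mem _ _ _ (Finset.mem_inter.1 hi).2]
  obtain ⟨V, -, hV⟩ := exists_indic_of_coeff_ne_zero key (S := S) (by
    rw [Finset.sum_eq_single S]
    · simpa [monom] using (hS S subset_rfl).2 rfl
    · intro U hU hne
      have hSU : S ⊆ U := Finset.inter_eq_right.1 (Finset.mem_filter.1 hU).2
      rw [not_not.1 fun h0 => hne ((hS U hSU).1 h0), zero_mul]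
    · simp)
  exact ⟨_, hV⟩

theorem two_pow_card_le_of_mem_degLE {d : ℕ} {h : (ι → Bool) → ℝ} (hh : h ∈ degLE ι d)
    (hne : ∃ x, h x ≠ 0) :
    2 ^ Fintype.card ι ≤ 2 ^ d * (Finset.univ.filter fun x => h x ≠ 0).card := by
  obtain ⟨c, hc0, hc⟩ := exists_coeff_of_mem_degLE hh
  have hcne : (Finset.univ.filter fun S => c S ≠ 0).Nonempty := by
    by_contra hemp
    obtain ⟨x, hx⟩ := hne
    refine hx ((hc x).trans (Finset.sum_eq_zero fun S _ => ?_))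
    have h0 : c S = 0 := by
      by_contra h0
      exact hemp ⟨S, by simp [h0]⟩
    rw [h0, zero_mul]
  obtain ⟨S, hS⟩ := Finset.exists_maximal hcne
  have hcS : c S ≠ 0 := (Finset.mem_filter.1 hS.prop).2
  have hSd : S.card ≤ d := not_lt.1 fun hlt => hcS (hc0 S hlt)
  have hmax : ∀ U, S ⊆ U → (c U ≠ 0 ↔ U = S) := fun U hU =>
    ⟨fun h0 => subset_antisymm (hS.le_of_ge (y := U) (by simp [h0]) hU) hU,
      fun e => e ▸ hcS⟩
  -- Every point of the cube arises from a point of the support by overwriting its bits in `S`.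
  have hsurj : Function.Surjective
      (fun p : (S → Bool) × {x // x ∈ Finset.univ.filter fun x => h x ≠ 0} =>
        (fun i => if hi : i ∈ S then p.1 ⟨i, hi⟩ else p.2.1 i : ι → Bool)) := by
    intro x
    obtain ⟨y, hy⟩ := exists_piecewise_ne_zero hc hmax x
    refine ⟨(fun i => x i, ⟨_, by simpa using hy⟩), ?_⟩
    ext i
    by_cases hi : i ∈ S <;> simp [hi]
  have := Fintype.card_le_of_surjective _ hsurj
  simp only [Fintype.card_fun, Fintype.card_prod, Fintype.card_bool, Fintype.card_coe] at this
  exact this.trans (Nat.mul_le_mul_right _ (Nat.pow_le_pow_right two_pos hSd))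

omit [Fintype ι] in
theorem xor_indic_singleton (x : ι → Bool) (i : ι) :
    (fun j => xor (x j) (indic {i} j)) = Function.update x i (!x i) := by
  ext j
  by_cases h : j = i
  · subst h; simp [indic]
  · simp [indic, h]

theorem card_sensitive_le {d : ℕ} {f : (ι → Bool) → Bool} (hf : realFun f ∈ degLE ι d)
    (x : ι → Bool) :
    (Finset.univ.filter fun i => f (Function.update x i (!x i)) ≠ f x).card ≤ 4 * d ^ 2 := by
  refine card_blocks_le (f := fun y => f fun i => xor (x i) (y i)) (comp_xor_mem_degLE hf x) _
    (fun i => {i}) (fun i _ j _ hij => Finset.disjoint_singleton.2 hij) fun i hi => ?_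
  rw [xor_indic_singleton]
  simpa [indic] using hi

/-- The difference of `f` and its translate in direction `i` still has degree at most `d`, and its
support is the set of points sensitive to `i`. -/
theorem two_pow_card_le_influence {d : ℕ} {f : (ι → Bool) → Bool} (hf : realFun f ∈ degLE ι d)
    {i : ι} (hi : ∃ x, f (Function.update x i (!x i)) ≠ f x) :
    2 ^ Fintype.card ι ≤
      2 ^ d * (Finset.univ.filter fun x => f (Function.update x i (!x i)) ≠ f x).card := by
  have h := Submodule.sub_mem _ (comp_xor_mem_degLE hf (indic {i})) hf
  have e : ∀ x : ι → Bool,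
      ((fun x : ι → Bool => realFun f fun j => xor (indic {i} j) (x j)) - realFun f) x ≠ 0 ↔
      f (Function.update x i (!x i)) ≠ f x := by
    intro x
    simp only [Pi.sub_apply, Bool.xor_comm (indic {i} _), xor_indic_singleton, sub_ne_zero,
      realFun]
    cases f (Function.update x i (!x i)) <;> cases f x <;> simp [bitReal]
  have := two_pow_card_le_of_mem_degLE h (by simpa only [e] using hi)
  simpa only [e] using this

end Counting

theorem card_relevantVars_le {n d : ℕ} {f : BoolFun n} (hf : realFun f ∈ degLE (Fin n) d) :
    (relevantVars f).card ≤ 4 * d ^ 2 * 2 ^ d := by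
  classical
  refine Nat.le_of_mul_le_mul_right ?_ (Nat.two_pow_pos n)
  calc (relevantVars f).card * 2 ^ n
      = ∑ i ∈ relevantVars f, 2 ^ n := by rw [Finset.sum_const, smul_eq_mul]
    _ ≤ ∑ i ∈ relevantVars f, 2 ^ d *
          (Finset.univ.filter fun x => f (Function.update x i (!x i)) ≠ f x).card := by
        refine Finset.sum_le_sum fun i hi => ?_
        simpa using two_pow_card_le_influence hf (Finset.mem_filter.1 hi).2
    _ ≤ ∑ i, 2 ^ d * (Finset.univ.filter fun x => f (Function.update x i (!x i)) ≠ f x).card :=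
        Finset.sum_le_sum_of_subset (Finset.subset_univ _)
    _ = 2 ^ d * ∑ x, (Finset.univ.filter fun i => f (Function.update x i (!x i)) ≠ f x).card := by
        rw [← Finset.mul_sum]
        simp_rw [Finset.card_filter]
        rw [Finset.sum_comm]
    _ ≤ 2 ^ d * ∑ _x : Fin n → Bool, 4 * d ^ 2 :=
        Nat.mul_le_mul_left _ (Finset.sum_le_sum fun x _ => card_sensitive_le hf x)
    _ = 4 * d ^ 2 * 2 ^ d * 2 ^ n := by
        rw [Finset.sum_const, smul_eq_mul, Finset.card_univ, Fintype.card_fun, Fintype.card_bool,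
          Fintype.card_fin]
        ring

theorem logb_sub_le_of_le {k d : ℕ} (hk : 2 ≤ k) (h : k ≤ 4 * d ^ 2 * 2 ^ d) :
    Real.logb 2 k - 6 * Real.logb 2 (Real.logb 2 k) ≤ d := by
  have hk' : (2 : ℝ) ≤ k := by exact_mod_cast hk
  have hL1 : 1 ≤ Real.logb 2 k := by
    rw [Real.le_logb_iff_rpow_le one_lt_two (by linarith)]
    simpa using hk'
  have hLL : 0 ≤ Real.logb 2 (Real.logb 2 k) := Real.logb_nonneg one_lt_two hL1
  rcases le_or_gt (Real.logb 2 k) d with hle | hlt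
  · linarith
  have hd : d ≠ 0 := by
    rintro rfl
    simp at h
    omega
  have hd1 : (1 : ℝ) ≤ d := by exact_mod_cast Nat.one_le_iff_ne_zero.2 hd
  -- The iterated logarithm vanishes at `k = 2`, but there `d < 1` contradicts `hd`. From `k ≥ 3` it
  -- is at least `1 / 2`, so the additive `2` in `hmain` costs four copies of it; with the two from
  -- `hlogd` this makes `6`.
  have hk3 : (3 : ℝ) ≤ k := by
    rcases hk.eq_or_lt with rfl | h3
    · simp at hlt
      omega
    · exact_mod_cast h3
  have hL : 3 / 2 ≤ Real.logb 2 k := by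
    have : Real.logb 2 ((2 : ℝ) ^ 3) ≤ Real.logb 2 ((k : ℝ) ^ 2) :=
      Real.logb_le_logb_of_le one_lt_two (by norm_num) (by nlinarith)
    rw [Real.logb_pow, Real.logb_pow, Real.logb_self_eq_one one_lt_two] at this
    push_cast at this
    linarith
  have hLL2 : 1 / 2 ≤ Real.logb 2 (Real.logb 2 k) := by
    have : Real.logb 2 2 ≤ Real.logb 2 ((Real.logb 2 k) ^ 2) :=
      Real.logb_le_logb_of_le one_lt_two two_pos (by nlinarith)
    rw [Real.logb_pow, Real.logb_self_eq_one one_lt_two] at this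
    push_cast at this
    linarith
  have hlogd : Real.logb 2 d ≤ Real.logb 2 (Real.logb 2 k) :=
    Real.logb_le_logb_of_le one_lt_two (by linarith) hlt.le
  have hmain : Real.logb 2 k ≤ 2 + 2 * Real.logb 2 d + d := by
    have h' : (k : ℝ) ≤ 2 ^ 2 * (d : ℝ) ^ 2 * 2 ^ d := by
      have : (k : ℝ) ≤ 4 * (d : ℝ) ^ 2 * 2 ^ d := by exact_mod_cast h
      linarith
    have := Real.logb_le_logb_of_le one_lt_two (by linarith) h'
    rw [Real.logb_mul (by positivity) (by positivity), Real.logb_mul (by positivity)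
      (by positivity), Real.logb_pow, Real.logb_pow, Real.logb_pow,
      Real.logb_self_eq_one one_lt_two] at this
    push_cast at this
    linarith
  linarith

/-! ### Decision trees -/

theorem decisionTreeComplexity_le {n : ℕ} {f : BoolFun n} {T : DecisionTree n}
    (hT : T.Computes f) : decisionTreeComplexity f ≤ T.depth :=
  Nat.sInf_le ⟨T, hT, rfl⟩

theorem exists_tree_depth_eq {n : ℕ} (f : BoolFun n) :
    ∃ T : DecisionTree n, T.Computes f ∧ T.depth = decisionTreeComplexity f :=
  Nat.sInf_mem (s := {d : ℕ | ∃ T : DecisionTree n, T.Computes f ∧ T.depth = d})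
    (let ⟨T, hT⟩ := exists_decisionTree f; ⟨_, T, hT, rfl⟩)

theorem exists_tree_of_piecewise {n e : ℕ} (H : Finset (Fin n)) (f : BoolFun n)
    (h : ∀ ρ : Fin n → Bool, ∃ T : DecisionTree n,
      T.Computes (fun x => f (H.piecewise ρ x)) ∧ T.depth ≤ e) :
    ∃ T : DecisionTree n, T.Computes f ∧ T.depth ≤ H.card + e := by
  induction H using Finset.induction_on generalizing f with
  | empty => simpa using h fun _ => false
  | insert i H hi ih =>
    have hb : ∀ b : Bool, ∃ T : DecisionTree n,
        T.Computes (fun x => f (Function.update x i b)) ∧ T.depth ≤ H.card + e := by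
      intro b
      refine ih (fun x => f (Function.update x i b)) fun ρ => ?_
      obtain ⟨T, hT, hTe⟩ := h (Function.update ρ i b)
      refine ⟨T, fun x => (hT x).trans ?_, hTe⟩
      refine congrArg f (funext fun j => ?_)
      by_cases hj : j = i
      · subst hj; simp
      · by_cases hjH : j ∈ H <;> simp [hj, hjH]
    obtain ⟨T₀, h₀, d₀⟩ := hb false
    obtain ⟨T₁, h₁, d₁⟩ := hb true
    refine ⟨.node i T₀ T₁, fun x => ?_, ?_⟩
    · cases hx : x i with
      | false =>
        have e : Function.update x i false = x := by rw [← hx]; exact Function.update_eq_self i x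
        simp [DecisionTree.eval, hx, h₀ x, e]
      | true =>
        have e : Function.update x i true = x := by rw [← hx]; exact Function.update_eq_self i x
        simp [DecisionTree.eval, hx, h₁ x, e]
    · rw [DecisionTree.depth, Finset.card_insert_of_notMem hi]
      have := max_le d₀ d₁
      omega

/-- Pass from `x` to `y` one coordinate at a time; only irrelevant bits ever change. -/
theorem eq_of_eqOn_relevantVars {n : ℕ} (f : BoolFun n) {x y : Fin n → Bool}
    (h : ∀ i ∈ relevantVars f, x i = y i) : f x = f y := by
  have key : ∀ W : Finset (Fin n), f (W.piecewise y x) = f x := by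
    intro W
    induction W using Finset.induction_on with
    | empty => simp
    | insert i W _ ih =>
      rw [Finset.piecewise_insert, ← ih]
      set z := W.piecewise y x with hz
      by_cases hi : i ∈ relevantVars f
      · have : y i = z i := by
          by_cases hW : i ∈ W <;> simp [hz, hW, h i hi]
        rw [this, Function.update_eq_self]
      · rcases Bool.eq_or_eq_not (y i) (z i) with e | e
        · rw [e, Function.update_eq_self]
        · rw [e]
          by_contra hne
          exact hi (by simpa [relevantVars] using ⟨z, hne⟩)
  rw [← key Finset.univ, Finset.piecewise_univ]

theorem decisionTreeComplexity_le_card_relevantVars {n : ℕ} (f : BoolFun n) :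
    decisionTreeComplexity f ≤ (relevantVars f).card := by
  obtain ⟨T, hT, hd⟩ := exists_tree_of_piecewise (e := 0) (relevantVars f) f fun ρ =>
    ⟨.leaf (f ρ), fun x => eq_of_eqOn_relevantVars f fun i hi => by simp [hi], le_rfl⟩
  exact (decisionTreeComplexity_le hT).trans hd

theorem DecisionTree.realFun_eval_mem_degLE {n : ℕ} (T : DecisionTree n) :
    realFun T.eval ∈ degLE (Fin n) T.depth := by
  induction T with
  | leaf b =>
    have e : realFun (DecisionTree.leaf (n := n) b).eval = bitReal b • monom ∅ := by
      ext x
      simp [realFun, DecisionTree.eval, monom]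
    rw [e]
    exact Submodule.smul_mem _ _ (monom_mem_degLE (Nat.zero_le _))
  | node i t₀ t₁ h₀ h₁ =>
    have m₀ := degLE_mono (le_max_left t₀.depth t₁.depth) h₀
    have m₁ := degLE_mono (le_max_right t₀.depth t₁.depth) h₁
    -- A query interpolates linearly between the two subtrees, which raises the degree by at most
    -- one.
    have e : realFun (DecisionTree.node i t₀ t₁).eval =
        realFun t₀.eval + fun x => bitReal (x i) * (realFun t₁.eval - realFun t₀.eval) x := by
      ext x
      cases hx : x i <;> simp [realFun, DecisionTree.eval, hx, bitReal]
    rw [e]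
    exact Submodule.add_mem _ (degLE_mono (Nat.le_succ _) m₀)
      (mul_bitReal_mem_degLE (Submodule.sub_mem _ m₁ m₀) i)

/-! ### Querying a hitting set of the monomials of top degree -/

theorem comp_piecewise_mem_degLE {ι : Type*} [DecidableEq ι] [Fintype ι] {d : ℕ}
    {h : (ι → Bool) → ℝ} {c : Finset ι → ℝ} (hc0 : ∀ S, d + 1 < S.card → c S = 0)
    (hc : ∀ x, h x = ∑ S, c S * monom S x) {H : Finset ι}
    (hH : ∀ S, S.card = d + 1 → c S ≠ 0 → ¬ Disjoint S H) (ρ : ι → Bool) :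
    (fun x => h (H.piecewise ρ x)) ∈ degLE ι d := by
  have e : (fun x => h (H.piecewise ρ x)) = ∑ S, c S • fun x => ∏ i ∈ S,
      ((if i ∈ H then 0 else 1) * bitReal (x i) + if i ∈ H then bitReal (ρ i) else 0) := by
    ext x
    rw [hc, Finset.sum_apply]
    refine Finset.sum_congr rfl fun S _ => ?_
    rw [Pi.smul_apply, smul_eq_mul, monom]
    congr 1
    refine Finset.prod_congr rfl fun i _ => ?_
    by_cases hi : i ∈ H <;> simp [hi]
  rw [e]
  refine Submodule.sum_mem _ fun S _ => ?_
  by_cases hS : c S = 0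
  · simp [hS]
  refine Submodule.smul_mem _ _ (prod_affine_mem_degLE S _ _ ?_)
  have hle : S.card ≤ d + 1 := not_lt.1 fun hlt => hS (hc0 S hlt)
  rcases hle.eq_or_lt with heq | hlt
  · obtain ⟨i, hiS, hiH⟩ := Finset.not_disjoint_iff.1 (hH S heq hS)
    have hlt := Finset.card_lt_card (Finset.filter_ssubset
      (p := fun i => (if i ∈ H then (0 : ℝ) else 1) ≠ 0).2 ⟨i, hiS, by simp [hiH]⟩)
    omega
  · exact (Finset.card_filter_le _ _).trans (Nat.le_of_lt_succ hlt)

/-- Each member of a maximal disjoint family of top-degree monomials contains a block sensitive at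
the zero input, so there are at most `4 * (d + 1) ^ 2` members with `d + 1` variables each.
Maximality makes their union meet every other top-degree monomial. -/
theorem exists_hitting_set {ι : Type*} [DecidableEq ι] [Fintype ι] {d : ℕ}
    {f : (ι → Bool) → Bool} (hf : realFun f ∈ degLE ι (d + 1)) {c : Finset ι → ℝ}
    (hc : ∀ x, realFun f x = ∑ S, c S * monom S x) :
    ∃ H : Finset ι, H.card ≤ 4 * (d + 1) ^ 3 ∧
      ∀ S, S.card = d + 1 → c S ≠ 0 → ¬ Disjoint S H := by
  classical
  set M : Finset (Finset ι) := Finset.univ.filter fun S => S.card = d + 1 ∧ c S ≠ 0 with hM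
  obtain ⟨A, hA⟩ := (M.powerset.filter fun A : Finset (Finset ι) =>
    (A : Set (Finset ι)).PairwiseDisjoint id).exists_maximal ⟨∅, by simp⟩
  have hA1 := Finset.mem_filter.1 hA.prop
  have hAM : A ⊆ M := Finset.mem_powerset.1 hA1.1
  have hblock : ∀ S ∈ A, ∃ V ⊆ S, f (indic V) ≠ f (indic ∅) := by
    intro S hS
    have hSM := (Finset.mem_filter.1 (hAM hS)).2
    obtain ⟨V, hV, hne⟩ := exists_block_of_coeff_ne_zero hc hSM.2
      (Finset.card_pos.1 (by omega))
    exact ⟨V, hV, fun h => hne (congrArg bitReal h)⟩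
  choose! B hBS hB using hblock
  have hcard : A.card ≤ 4 * (d + 1) ^ 2 := card_blocks_le hf A B
    (fun S hS T hT hST => (hA1.2 hS hT hST).mono (hBS S hS) (hBS T hT)) hB
  refine ⟨A.biUnion id, ?_, fun S hS hcS hdisj => ?_⟩
  · refine (Finset.card_biUnion_le_card_mul A id (d + 1) fun S hS =>
      ((Finset.mem_filter.1 (hAM hS)).2.1).le).trans ?_
    calc _ ≤ 4 * (d + 1) ^ 2 * (d + 1) := Nat.mul_le_mul_right _ hcard
      _ = _ := by ring
  · have hSM : S ∈ M := by simp [hM, hS, hcS]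
    have hSA : ∀ T ∈ A, Disjoint S T := fun T hT =>
      hdisj.mono_right (Finset.subset_biUnion_of_mem id hT)
    have hin : insert S A ⊆ A := hA.le_of_ge (y := insert S A) (by
      rw [Finset.mem_filter, Finset.mem_powerset, Finset.coe_insert]
      refine ⟨Finset.insert_subset hSM hAM, ?_⟩
      exact (Set.pairwiseDisjoint_insert.2 ⟨hA1.2, fun T hT _ => hSA T hT⟩))
      (Finset.subset_insert S A)
    have := hSA S (hin (Finset.mem_insert_self S A))
    rw [Finset.disjoint_self_iff_empty] at this
    simp [this] at hS

theorem exists_tree_of_mem_degLE {n : ℕ} (d : ℕ) (f : BoolFun n)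
    (hf : realFun f ∈ degLE (Fin n) d) :
    ∃ T : DecisionTree n, T.Computes f ∧ T.depth ≤ 4 * d ^ 4 := by
  induction d generalizing f with
  | zero =>
    obtain ⟨c, hc0, hc⟩ := exists_coeff_of_mem_degLE hf
    have hconst : ∀ x, realFun f x = c ∅ := by
      intro x
      rw [hc, Finset.sum_eq_single ∅]
      · simp [monom]
      · intro S _ hS
        rw [hc0 S (Finset.card_pos.2 (Finset.nonempty_iff_ne_empty.2 hS)), zero_mul]
      · simp
    refine ⟨.leaf (f fun _ => false), fun x => ?_, le_rfl⟩
    have := (hconst fun _ => false).trans (hconst x).symm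
    simp only [realFun, bitReal] at this
    rw [DecisionTree.eval]
    cases h1 : f x <;> cases h2 : f fun _ => false <;> simp [h1, h2] at this ⊢
  | succ d ih =>
    obtain ⟨c, hc0, hc⟩ := exists_coeff_of_mem_degLE hf
    obtain ⟨H, hHcard, hH⟩ := exists_hitting_set hf hc
    -- One hitting set serves all answers `ρ`, because the top-degree monomials are those of `f`
    -- itself.
    obtain ⟨T, hT, hd⟩ := exists_tree_of_piecewise H f fun ρ =>
      ih _ (comp_piecewise_mem_degLE hc0 hc hH ρ)
    refine ⟨T, hT, hd.trans ((Nat.add_le_add_right hHcard _).trans ?_)⟩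
    have : d ^ 4 ≤ d * (d + 1) ^ 3 := by
      rw [pow_succ, mul_comm]
      gcongr
      omega
    calc 4 * (d + 1) ^ 3 + 4 * d ^ 4 ≤ 4 * (d + 1) ^ 3 + 4 * (d * (d + 1) ^ 3) := by gcongr
      _ = 4 * (d + 1) ^ 4 := by ring

/-! ### The Fourier expansion and the degree of the Hamiltonian -/

theorem zCoeff_hamiltonian {n : ℕ} (f : BoolFun n) (S : Finset (Fin n)) :
    zCoeff (hamiltonian f) S =
      ((∑ x, realFun f x * ∏ i ∈ S, (-2 * bitReal (x i) + 1) : ℝ) : ℂ) / 2 ^ n := by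
  rw [zCoeff, hamiltonian_eq_diagonal, zString_eq_diagonal, Matrix.diagonal_mul_diagonal,
    Matrix.trace_diagonal]
  congr 1
  push_cast
  refine Finset.sum_congr rfl fun x _ => ?_
  congr 1
  · cases h : f x <;> simp [realFun, bitReal, bitVal, h]
  · refine Finset.prod_congr rfl fun i _ => ?_
    cases x i <;> norm_num [bitReal]

theorem realFun_eq_sum_zCoeff {n : ℕ} (f : BoolFun n) :
    realFun f = ∑ S, (zCoeff (hamiltonian f) S).re •
      fun x => ∏ i ∈ S, (-2 * bitReal (x i) + 1) := by
  ext x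
  have h := congrArg Complex.re (congrFun (congrFun (hamiltonian_expansion f) x) x)
  rw [hamiltonian_eq_diagonal, Matrix.diagonal_apply_eq, ← hamiltonian_eq_diagonal,
    Matrix.sum_apply, Complex.re_sum] at h
  rw [Finset.sum_apply]
  refine Eq.trans ?_ (h.trans (Finset.sum_congr rfl fun S _ => ?_))
  · cases h : f x <;> simp [realFun, bitReal, bitVal, h]
  · have e : (∏ i ∈ S, if x i then (-1 : ℂ) else 1) =
        ((∏ i ∈ S, (-2 * bitReal (x i) + 1) : ℝ) : ℂ) := by
      push_cast
      refine Finset.prod_congr rfl fun i _ => ?_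
      cases x i <;> norm_num [bitReal]
    rw [Matrix.smul_apply, zString_eq_diagonal, Matrix.diagonal_apply_eq, smul_eq_mul, e,
      Complex.re_mul_ofReal, Pi.smul_apply, smul_eq_mul]

theorem realFun_mem_degLE_hamDegree {n : ℕ} (f : BoolFun n) :
    realFun f ∈ degLE (Fin n) (hamDegree (hamiltonian f)) := by
  rw [realFun_eq_sum_zCoeff]
  refine Submodule.sum_mem _ fun S _ => ?_
  by_cases hS : zCoeff (hamiltonian f) S = 0
  · simp [hS]
  · refine Submodule.smul_mem _ _ (prod_affine_mem_degLE S _ _ ((Finset.card_filter_le _ _).trans ?_))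
    exact Finset.le_sup (f := Finset.card) (by simpa using hS)

/-- A monomial of degree below `|S|` misses some `i ∈ S`. Flipping bit `i` fixes the monomial and
negates the character, so the terms cancel in pairs. -/
theorem sum_mul_character_eq_zero {ι : Type*} [DecidableEq ι] [Fintype ι] {d : ℕ}
    {h : (ι → Bool) → ℝ} (hh : h ∈ degLE ι d) {S : Finset ι} (hS : d < S.card) :
    ∑ x, h x * ∏ i ∈ S, (-2 * bitReal (x i) + 1) = 0 := by
  induction hh using Submodule.span_induction with
  | mem h hm =>
    obtain ⟨U, hU, rfl⟩ := hm
    obtain ⟨i, hiS, hiU⟩ := Finset.exists_mem_notMem_of_card_lt_card (lt_of_le_of_lt hU hS)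
    have hinv : Function.Involutive fun x : ι → Bool => Function.update x i (!x i) := by
      intro x; simp
    have hneg : ∀ x : ι → Bool, monom U (Function.update x i (!x i)) *
        ∏ j ∈ S, (-2 * bitReal (Function.update x i (!x i) j) + 1) =
        -(monom U x * ∏ j ∈ S, (-2 * bitReal (x j) + 1)) := by
      intro x
      have h1 : monom U (Function.update x i (!x i)) = monom U x :=
        Finset.prod_congr rfl fun j hj => by
          rw [Function.update_of_ne (show j ≠ i from fun e => hiU (e ▸ hj))]
      have h2 : ∏ j ∈ S.erase i, (-2 * bitReal (Function.update x i (!x i) j) + 1) =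
          ∏ j ∈ S.erase i, (-2 * bitReal (x j) + 1) :=
        Finset.prod_congr rfl fun j hj => by
          rw [Function.update_of_ne (Finset.ne_of_mem_erase hj)]
      rw [h1, ← Finset.mul_prod_erase S _ hiS, ← Finset.mul_prod_erase S _ hiS, h2,
        Function.update_self]
      cases x i <;> norm_num [bitReal]
    have := Equiv.sum_comp hinv.toPerm fun x =>
      monom U x * ∏ j ∈ S, (-2 * bitReal (x j) + 1)
    simp only [Function.Involutive.coe_toPerm, hneg, Finset.sum_neg_distrib] at this
    linarith
  | zero => simp
  | add f g _ _ hf hg => simp only [Pi.add_apply, add_mul, Finset.sum_add_distrib, hf, hg, add_zero]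
  | smul a f _ hf => simp only [Pi.smul_apply, smul_eq_mul, mul_assoc, ← Finset.mul_sum, hf, mul_zero]

theorem hamDegree_le_of_mem_degLE {n d : ℕ} {f : BoolFun n} (hf : realFun f ∈ degLE (Fin n) d) :
    hamDegree (hamiltonian f) ≤ d := by
  refine Finset.sup_le fun S hS => ?_
  by_contra hlt
  refine (Finset.mem_filter.1 hS).2 ?_
  rw [zCoeff_hamiltonian, sum_mul_character_eq_zero hf (not_le.1 hlt)]
  simp

theorem hamDegree_le_decisionTreeComplexity {n : ℕ} (f : BoolFun n) :
    hamDegree (hamiltonian f) ≤ decisionTreeComplexity f := by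
  obtain ⟨T, hT, hd⟩ := exists_tree_depth_eq f
  rw [← hd, ← funext hT]
  exact hamDegree_le_of_mem_degLE T.realFun_eval_mem_degLE

end HamRep

theorem mainTheorem10 :
    (∀ (n : ℕ) (f : HamRep.BoolFun n),
      HamRep.decisionTreeComplexity f ≤ (HamRep.relevantVars f).card ∧
      HamRep.hamDegree (HamRep.hamiltonian f) ≤ HamRep.decisionTreeComplexity f) ∧
    (∃ C : ℝ, ∀ (n : ℕ) (f : HamRep.BoolFun n) (k : ℕ),
      (HamRep.relevantVars f).card = k → 2 ≤ k →
      Real.logb 2 k - C * Real.logb 2 (Real.logb 2 k) ≤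
        (HamRep.hamDegree (HamRep.hamiltonian f) : ℝ)) ∧
    (∃ C c : ℕ, ∀ (n : ℕ) (f : HamRep.BoolFun n),
      HamRep.decisionTreeComplexity f ≤ C * HamRep.hamDegree (HamRep.hamiltonian f) ^ c) := by
  refine ⟨fun n f => ⟨HamRep.decisionTreeComplexity_le_card_relevantVars f,
    HamRep.hamDegree_le_decisionTreeComplexity f⟩, ⟨6, fun n f k hk h2 => ?_⟩,
    4, 4, fun n f => ?_⟩
  · exact HamRep.logb_sub_le_of_le h2
      (hk ▸ HamRep.card_relevantVars_le (HamRep.realFun_mem_degLE_hamDegree f))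
  · obtain ⟨T, hT, hd⟩ :=
      HamRep.exists_tree_of_mem_degLE _ f (HamRep.realFun_mem_degLE_hamDegree f)
    exact (HamRep.decisionTreeComplexity_le hT).trans hd
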